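/- **Lemma 4.2 (Finite time activity identification).** *Setting.* Let $F:\mathbb R^n\to\mathbb R$ be $C^1$, let $G:\mathbb R^n\to(-\infty,+\infty]$ be proper, lower semicontinuous and convex, and suppose that $\Phi=F+G$ is bounded from below. Let $\psi:\mathbb R^n\to\mathbb R$ be $C^2$ and $\sigma_\psi$-strongly convex with $\sigma_\psi>0$, let $L>0$ be such that $L\psi-F$ is convex, and suppose that $\nabla F$ and $\nabla\psi$ are Lipschitz continuous on bounded subsets of $\mathbb R^n$. *Algorithm (IBPG).* Let $\kappa\in\,]1,2]$ and $0<\underline a<\overline a\le 1$. Starting from $z_0=x_0\in\mathbb R^n$ and $a_0=1$, the algorithm generates, for $k=0,1,2,\dots$, $$y_k=z_k+a_k(x_k-z_k),\qquad x_{k+1}=(\nabla\psi+\gamma_k\partial G)^{-1}\bigl(\nabla\psi(y_k)-\gamma_k\nabla F(y_k)\bigr),\quad \gamma_k=\frac{a_k^{\kappa-1}}{L},\qquad z_{k+1}=x_k+a_k(x_{k+1}-x_k),$$ where $a_{k+1}\in[\underline a,\overline a]$ is chosen such that $(a_{k+1}^{1-\kappa}+1)^{1/\kappa}(1-a_{k+1})(1-a_k)<a_k^{1/\kappa-1}$.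 Here $\partial G$ is the subdifferential of convex analysis. *Notions.* A point $\bar x$ is critical for $\Phi$, written $\bar x\in\operatorname{crit}\Phi$, if $0\in\partial\Phi(\bar x)$ (limiting subdifferential); it is nondegenerate if it is critical and $-\nabla F(\bar x)\in\operatorname{ri}\partial G(\bar x)$. The function $G$ is $C^2$-partly smooth at $\bar x$ relative to a set $\mathcal M\ni\bar x$ if $\partial G(\bar x)\neq\emptyset$, $\mathcal M$ is a $C^2$ embedded submanifold of $\mathbb R^n$ around $\bar x$, the restriction $G|_{\mathcal M}$ is $C^2$ near $\bar x$ (it has a local $C^2$ extension), the linear subspace parallel to the affine hull of $\partial G(\bar x)$ is the normal space of $\mathcal M$ at $\bar x$, and $\partial G$ is continuous (inner and outer semicontinuous) at $\bar x$ relative to $\mathcal M$. The function $G$ is locally polyhedral around $\bar x$ if near $\bar x$ it agrees with a function whose epigraph is a polyhedron. *Statement.* Let $(x_k),(y_k),(z_k)$ be generated by IBPG, with $(x_k)$ bounded and converging to $\bar x\in\operatorname{crit}\Phi$. Suppose that $G$ is $C^2$-partly smooth at $\bar x$ relative to $\mathcal M_{\bar x}$ and that $\bar x$ is nondegenerate.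 Denote by $T_{\bar x}$ the tangent space of $\mathcal M_{\bar x}$ at $\bar x$. Then there exists $K\in\mathbb N$ such that $x_k\in\mathcal M_{\bar x}$ for all $k\ge K$, and moreover, with the same $K$: 1. if $\mathcal M_{\bar x}$ is an affine subspace, then $\mathcal M_{\bar x}=\bar x+T_{\bar x}$, and $y_k,z_k\in\mathcal M_{\bar x}$ for all $k\ge K$; 2. if $G$ is locally polyhedral around $\bar x$, then for all $k\ge K$ one has $y_k,z_k\in\mathcal M_{\bar x}$, and the Riemannian Hessian of $G$ along $\mathcal M_{\bar x}$ exists at $x_k$ and satisfies $\nabla^2_{\mathcal M_{\bar x}}G(x_k)=0$. -/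

import Mathlib

open Filter Topology
open scoped RealInnerProductSpace

namespace IBPG

variable {E : Type*} [NormedAddCommGroup E] [InnerProductSpace ℝ E]

/-! Extended-valued functions and subdifferentials -/

/-- The class `Γ₀`: proper, lower semicontinuous, convex functions with values in `(-∞, +∞]`;
convexity is convexity of the epigraph. -/
structure IsGammaZero (G : E → EReal) : Prop where
  ne_bot : ∀ u, G u ≠ ⊥
  exists_ne_top : ∃ u, G u ≠ ⊤
  lsc : LowerSemicontinuous G
  convex_epi : Convex ℝ {p : E × ℝ | G p.1 ≤ (p.2 : EReal)}

/-- The subdifferential of convex analysis, `{v | ∀ u, G u ≥ G x + ⟨v, u - x⟩}`. -/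
def subdiff (G : E → EReal) (x : E) : Set E :=
  {v | ∀ u, G x + ((⟪v, u - x⟫ : ℝ) : EReal) ≤ G u}

/-- The regular (Fréchet) subdifferential of an arbitrary extended-valued function. -/
def regularSubdiff (f : E → EReal) (x : E) : Set E :=
  {v | f x ≠ ⊤ ∧ f x ≠ ⊥ ∧ ∀ ε : ℝ, 0 < ε →
    ∀ᶠ u in 𝓝 x, f x + ((⟪v, u - x⟫ - ε * ‖u - x‖ : ℝ) : EReal) ≤ f u}

/-- The limiting subdifferential: limits of regular subgradients at points converging to `x`
together with their function values. -/
def limitingSubdiff (f : E → EReal) (x : E) : Set E :=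
  {v | f x ≠ ⊤ ∧ f x ≠ ⊥ ∧ ∃ u w : ℕ → E, Tendsto u atTop (𝓝 x) ∧
    Tendsto (fun j => f (u j)) atTop (𝓝 (f x)) ∧ Tendsto w atTop (𝓝 v) ∧
    ∀ j, w j ∈ regularSubdiff f (u j)}

/-- Critical points: `0 ∈ ∂f(x)`, with the limiting subdifferential since `f` may be nonconvex. -/
def IsCritical (f : E → EReal) (x : E) : Prop :=
  (0 : E) ∈ limitingSubdiff f x

/-- The composite objective `Φ = F + G`. -/
noncomputable def objective (F : E → ℝ) (G : E → EReal) (u : E) : EReal :=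
  (F u : EReal) + G u

/-- Nondegenerate critical points of `Φ = F + G`: `-∇F(x)` is in the relative interior of `∂G(x)`. -/
def IsNondegenerate [CompleteSpace E] (F : E → ℝ) (G : E → EReal) (x : E) : Prop :=
  IsCritical (objective F G) x ∧ -gradient F x ∈ intrinsicInterior ℝ (subdiff G x)

/-- `f` is Lipschitz continuous on bounded sets. -/
def LipschitzOnBounded (f : E → E) : Prop :=
  ∀ s : Set E, Bornology.IsBounded s → ∃ C, LipschitzOnWith C f s

/-! Embedded submanifolds and partial smoothness -/

/-- `M` is a `C²` embedded submanifold around its point `x`: near `x` it is the zero set of a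
`C²` map whose differential at `x` is onto. -/
def IsSubmanifoldAt (M : Set E) (x : E) : Prop :=
  x ∈ M ∧ ∃ (m : ℕ) (h : E → EuclideanSpace ℝ (Fin m)),
    ContDiffAt ℝ 2 h x ∧ Function.Surjective (fderiv ℝ h x) ∧ ∀ᶠ u in 𝓝 x, (u ∈ M ↔ h u = 0)

/-- The tangent space of `M` at `x`: the velocities at `x` of curves in `M` (for a submanifold
these already form a subspace; the span only serves to have a subspace for every set). -/
def tangent (M : Set E) (x : E) : Submodule ℝ E :=
  Submodule.span ℝ {v | ∃ c : ℝ → E, c 0 = x ∧ HasDerivAt c v 0 ∧ ∀ᶠ t in 𝓝 (0 : ℝ), c t ∈ M}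

/-- `g` is a local `C²` representative at `x` of the restriction of `G` to `M`. -/
def IsSmoothRep (G : E → EReal) (M : Set E) (x : E) (g : E → ℝ) : Prop :=
  ContDiffAt ℝ 2 g x ∧ ∀ᶠ u in 𝓝[M] x, G u = (g u : EReal)

/-- Continuity at `x` relative to `M` of a set-valued map (in the Painlevé-Kuratowski sense):
inner and outer semicontinuity. -/
def SetContinuousWithinAt (S : E → Set E) (M : Set E) (x : E) : Prop :=
  (∀ v ∈ S x, ∀ ε : ℝ, 0 < ε → ∀ᶠ u in 𝓝[M] x, ∃ w ∈ S u, ‖w - v‖ < ε) ∧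
  (∀ v, v ∉ S x → ∃ ε : ℝ, 0 < ε ∧ ∀ᶠ u in 𝓝[M] x, ∀ w ∈ S u, ε ≤ ‖w - v‖)

/-- `G` (in `Γ₀`) is `C²`-partly smooth at `x` relative to `M`. Sharpness says that the subspace
parallel to `∂G(x)` is the normal space of `M` at `x`. -/
structure IsPartlySmoothAt (G : E → EReal) (M : Set E) (x : E) : Prop where
  gammaZero : IsGammaZero G
  nonempty : (subdiff G x).Nonempty
  submanifold : IsSubmanifoldAt M x
  smooth : ∃ g, IsSmoothRep G M x g
  sharp : vectorSpan ℝ (subdiff G x) = (tangent M x)ᗮ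
  continuous : SetContinuousWithinAt (subdiff G) M x

/-- `G` is locally polyhedral around `x`: near `x` it agrees with a function whose epigraph is
a polyhedron, that is, the set of solutions of finitely many (non-strict) affine inequalities. -/
def IsLocallyPolyhedralAt (G : E → EReal) (x : E) : Prop :=
  ∃ (P : E → EReal) (m : ℕ) (p : Fin m → E) (s b : Fin m → ℝ),
    {q : E × ℝ | P q.1 ≤ (q.2 : EReal)} = {q : E × ℝ | ∀ i, ⟪p i, q.1⟫ + s i * q.2 ≤ b i} ∧
    ∀ᶠ u in 𝓝 x, G u = P u

section Riemannian

variable [FiniteDimensional ℝ E] [CompleteSpace E]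

/-- The Riemannian gradient along `M` of (the restriction to `M` of) a smooth function `g`:
the tangential part of the Euclidean gradient. -/
noncomputable def riemGradient (M : Set E) (g : E → ℝ) (u : E) : E :=
  (tangent M u).starProjection (gradient g u)

/-- `H` is the Riemannian Hessian at `x` of `G` along the submanifold `M` (the metric on `M` being
induced by `E`): `G` is `C²` along `M` near `x`, and `H h` is for every tangent vector `h` the
tangential part of the derivative in the direction `h` of the Riemannian gradient along `M`. -/
def HasRiemHessianAt (M : Set E) (G : E → EReal) (x : E)
    (H : tangent M x →ₗ[ℝ] tangent M x) : Prop :=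
  IsSubmanifoldAt M x ∧ ∃ g : E → ℝ, IsSmoothRep G M x g ∧
    ∃ D : E →L[ℝ] E, HasFDerivWithinAt (riemGradient M g) D M x ∧
      ∀ h : tangent M x, (H h : E) = (tangent M x).starProjection (D h)

end Riemannian

/-! The algorithm -/

/-- The step size `γₖ = aₖ^(κ-1) / L`. -/
noncomputable def stepSize (L κ : ℝ) (a : ℕ → ℝ) (k : ℕ) : ℝ :=
  a k ^ (κ - 1) / L

/-- `x, y, z` are sequences generated by the inertial Bregman proximal gradient algorithm for
`F + G` with kernel `ψ`, constant `L`, exponent `κ` and inertial parameters `a`. The update of `x`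
is `xₖ₊₁ ∈ (∇ψ + γₖ ∂G)⁻¹ (∇ψ(yₖ) - γₖ ∇F(yₖ))`. In the rule for `a` the denominator `1 - aₖ`
is multiplied out, so that the rule is void when `aₖ = 1`. -/
structure IsIBPG [CompleteSpace E] (F ψ : E → ℝ) (G : E → EReal) (L κ aMin aMax : ℝ)
    (a : ℕ → ℝ) (x y z : ℕ → E) : Prop where
  kappa_gt : 1 < κ
  kappa_le : κ ≤ 2
  aMin_pos : 0 < aMin
  aMin_lt : aMin < aMax
  aMax_le : aMax ≤ 1
  a_zero : a 0 = 1
  z_zero : z 0 = x 0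
  y_eq : ∀ k, y k = z k + a k • (x k - z k)
  x_succ : ∀ k, ∃ v ∈ subdiff G (x (k + 1)),
    gradient ψ (x (k + 1)) + stepSize L κ a k • v =
      gradient ψ (y k) - stepSize L κ a k • gradient F (y k)
  z_succ : ∀ k, z (k + 1) = x k + a k • (x (k + 1) - x k)
  a_succ_mem : ∀ k, a (k + 1) ∈ Set.Icc aMin aMax
  a_succ_lt : ∀ k, (a (k + 1) ^ (1 - κ) + 1) ^ (1 / κ) * (1 - a (k + 1)) * (1 - a k) <
    a k ^ (1 / κ - 1)

end IBPG

open IBPG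

/-! The update of `x` exhibits the subgradient `γₖ⁻¹(∇ψ(yₖ) - ∇ψ(xₖ₊₁)) - ∇F(yₖ)` of `G` at `xₖ₊₁`.
Since `y` and `z` also converge to `xbar` and the step sizes stay away from zero, these subgradients
tend to `-∇F(xbar)` (`exists_subgradients`), a relative interior point of `∂G(xbar)`.

Identification (`eventually_mem_of_tendsto_subgradient`) then uses only partial smoothness and
monotonicity of `∂G`: iterates off `M` would have offsets from `M` accumulating at a unit normal
direction, along which `∂G(xbar)` still has room, and monotonicity forbids this.

In the polyhedral case the epigraph is a cone near `(xbar, G xbar)`. This makes `G` affine on `M`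
near `xbar` and `M` equal to `xbar + T` there (`eventually_mem_iff_of_polyhedral`). On a flat `M`,
`y` and `z` follow `x` because they are affine combinations of consecutive iterates, and an affine
`G` has zero Hessian. -/

namespace IBPG

variable {E : Type*} [NormedAddCommGroup E] [InnerProductSpace ℝ E]

/-! Subgradients -/

theorem ne_top_of_mem_subdiff {G : E → EReal} (hG : IsGammaZero G) {x v : E}
    (hv : v ∈ subdiff G x) : G x ≠ ⊤ := by
  obtain ⟨u, hu⟩ := hG.exists_ne_top
  intro h
  have h1 := hv u
  rw [h, EReal.top_add_coe] at h1
  exact hu (top_le_iff.mp h1)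

theorem exists_coe_of_mem_subdiff {G : E → EReal} (hG : IsGammaZero G) {x v : E}
    (hv : v ∈ subdiff G x) : ∃ r : ℝ, G x = r :=
  ⟨_, (EReal.coe_toReal (ne_top_of_mem_subdiff hG hv) (hG.ne_bot x)).symm⟩

theorem le_of_mem_subdiff {G : E → EReal} {x v u : E} {r s : ℝ} (hv : v ∈ subdiff G x)
    (hx : G x = r) (hu : G u ≤ s) : r + ⟪v, u - x⟫ ≤ s := by
  have h := (hv u).trans hu
  rw [hx] at h
  exact_mod_cast h

theorem subdiff_monotone {G : E → EReal} (hG : IsGammaZero G) {x u v w : E}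
    (hv : v ∈ subdiff G x) (hw : w ∈ subdiff G u) : 0 ≤ ⟪v - w, x - u⟫ := by
  obtain ⟨r, hr⟩ := exists_coe_of_mem_subdiff hG hv
  obtain ⟨s, hs⟩ := exists_coe_of_mem_subdiff hG hw
  have h1 := le_of_mem_subdiff hv hr hs.le
  have h2 := le_of_mem_subdiff hw hs hr.le
  have h3 : ⟪v, u - x⟫ = -⟪v, x - u⟫ := by rw [← inner_neg_right, neg_sub]
  rw [inner_sub_left]
  linarith

theorem exists_add_mem_of_mem_intrinsicInterior {S : Set E} {v : E}
    (hv : v ∈ intrinsicInterior ℝ S) :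
    ∃ δ > 0, ∀ e ∈ vectorSpan ℝ S, ‖e‖ < δ → v + e ∈ S := by
  obtain ⟨y, hy, rfl⟩ := mem_intrinsicInterior.mp hv
  obtain ⟨δ, hδ, hb⟩ := Metric.mem_nhds_iff.mp (mem_interior_iff_mem_nhds.mp hy)
  refine ⟨δ, hδ, fun e he hlt => ?_⟩
  have hmem : (y : E) + e ∈ affineSpan ℝ S := by
    have := AffineSubspace.vadd_mem_of_mem_direction
      (by rw [direction_affineSpan]; exact he) y.2
    rwa [vadd_eq_add, add_comm] at this
  have : (⟨(y : E) + e, hmem⟩ : affineSpan ℝ S) ∈ Metric.ball y δ := by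
    rw [Metric.mem_ball, Subtype.dist_eq, dist_eq_norm]
    simpa using hlt
  exact hb this

/-! Submanifolds and their tangent spaces -/

theorem tangent_le_ker {F' : Type*} [NormedAddCommGroup F'] [NormedSpace ℝ F'] {M : Set E}
    {x : E} {h : E → F'} {h' : E →L[ℝ] F'} (hh : HasFDerivAt h h' x)
    (hM : ∀ᶠ u in 𝓝 x, u ∈ M → h u = 0) : tangent M x ≤ LinearMap.ker (h' : E →ₗ[ℝ] F') := by
  refine Submodule.span_le.mpr ?_
  rintro v ⟨c, hc0, hc, hcM⟩
  subst hc0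
  have h1 : HasDerivAt (h ∘ c) (h' v) 0 := hh.comp_hasDerivAt 0 hc
  have h2 : h ∘ c =ᶠ[𝓝 0] fun _ => 0 := by
    filter_upwards [hcM, hc.continuousAt.eventually hM] with t ht1 ht2 using ht2 ht1
  have h3 := (hasDerivAt_const (0 : ℝ) (0 : F')).congr_of_eventuallyEq h2
  exact h1.unique h3

/-- Implicit function theorem with the orthogonal projection onto `ker h'(x)` as second coordinate:
`π p` is the zero of `h` with the same projection as `p`. The inclusion of the tangent space in the
kernel is enough, as orthogonal complements reverse it. -/
theorem exists_normal_retraction [CompleteSpace E] {M : Set E} {x : E}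
    (hM : IsSubmanifoldAt M x) :
    ∃ π : E → E, Tendsto π (𝓝 x) (𝓝 x) ∧
      ∀ᶠ p in 𝓝 x, π p ∈ M ∧ p - π p ∈ (tangent M x)ᗮ := by
  obtain ⟨hx, m, h, hC, hsurj, hiff⟩ := hM
  have hstrict : HasStrictFDerivAt h (fderiv ℝ h x) x := hC.hasStrictFDerivAt (by norm_num)
  set K : Submodule ℝ E := (fderiv ℝ h x).ker with hK
  have hKc : IsClosed (K : Set E) := (fderiv ℝ h x).isClosed_ker
  have : CompleteSpace K := hKc.completeSpace_coe
  have hTK : tangent M x ≤ K :=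
    tangent_le_ker hstrict.hasFDerivAt (hiff.mono fun u hu => hu.mp)
  let φ : ImplicitFunctionData ℝ E (EuclideanSpace ℝ (Fin m)) K :=
    { leftFun := h
      leftDeriv := fderiv ℝ h x
      rightFun := K.orthogonalProjectionOnto
      rightDeriv := K.orthogonalProjectionOnto
      pt := x
      hasStrictFDerivAt_leftFun := hstrict
      hasStrictFDerivAt_rightFun := K.orthogonalProjectionOnto.hasStrictFDerivAt
      range_leftDeriv := LinearMap.range_eq_top.mpr hsurj
      range_rightDeriv := LinearMap.range_eq_top.mpr fun w => ⟨w, by simp⟩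
      isCompl_ker := by
        rw [K.ker_orthogonalProjectionOnto]
        exact K.isCompl_orthogonal }
  have hx0 : h x = 0 := hiff.self_of_nhds.mp hx
  have htend : Tendsto (fun p => φ.implicitFunction 0 (K.orthogonalProjectionOnto p)) (𝓝 x) (𝓝 x) := by
    have h1 := φ.differentiableAt_implicitFunction.continuousAt
    have h2 : φ.implicitFunction (φ.leftFun φ.pt) (φ.rightFun φ.pt) = x :=
      φ.implicitFunction_apply_image.self_of_nhds
    have h3 : ContinuousAt (K.orthogonalProjectionOnto : E → K) x :=
      K.orthogonalProjectionOnto.continuous.continuousAt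
    have h4 := Tendsto.comp (f := (K.orthogonalProjectionOnto : E → K)) h1.tendsto h3.tendsto
    rw [h2] at h4
    have h5 : φ.leftFun φ.pt = 0 := hx0
    rw [h5] at h4
    exact h4
  refine ⟨_, htend, ?_⟩
  have hL := φ.leftFun_implicitFunction_eq_leftFun
  have hR := φ.rightFun_implicitFunction_eq_rightFun
  have h5 : φ.leftFun φ.pt = 0 := hx0
  rw [h5] at hL hR
  filter_upwards [hL, hR, htend.eventually hiff] with p hp1 hp2 hp3
  refine ⟨hp3.mpr hp1, Submodule.orthogonal_le hTK ?_⟩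
  rw [← Submodule.ker_orthogonalProjectionOnto, LinearMap.mem_ker]
  have hp2' : K.orthogonalProjectionOnto (φ.implicitFunction 0 (K.orthogonalProjectionOnto p)) =
    K.orthogonalProjectionOnto p := hp2
  change K.orthogonalProjectionOnto (p - φ.implicitFunction 0 (K.orthogonalProjectionOnto p)) = 0
  rw [map_sub, hp2', sub_self]

/-- The base point `p` is separate from `x` so that one flat description of `M` serves all nearby
points. -/
theorem tangent_eq_of_locally_affine {M : Set E} {x p : E} {T : Submodule ℝ E}
    [T.HasOrthogonalProjection] (hx : x - p ∈ T) (h : ∀ᶠ u in 𝓝 x, (u ∈ M ↔ u - p ∈ T)) :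
    tangent M x = T := by
  apply le_antisymm
  · have hd : HasFDerivAt (fun u => Tᗮ.starProjection (u - p)) Tᗮ.starProjection x :=
      Tᗮ.starProjection.hasFDerivAt.comp x ((hasFDerivAt_id x).sub_const p)
    refine (tangent_le_ker hd (h.mono fun u hu hm => ?_)).trans fun v hv => ?_
    · rw [Submodule.starProjection_apply_eq_zero_iff]
      exact T.le_orthogonal_orthogonal (hu.mp hm)
    · have hv' : Tᗮ.starProjection v = 0 := hv
      rwa [Submodule.starProjection_apply_eq_zero_iff, T.orthogonal_orthogonal] at hv'
  · intro v hv
    refine Submodule.subset_span ⟨fun t => x + t • v, by simp, ?_, ?_⟩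
    · simpa using ((hasDerivAt_id (0 : ℝ)).smul_const v).const_add x
    · have hc : Tendsto (fun t : ℝ => x + t • v) (𝓝 0) (𝓝 x) := by
        have : Continuous fun t : ℝ => x + t • v := by fun_prop
        simpa using this.tendsto 0
      filter_upwards [hc.eventually h] with t ht
      rw [ht, add_sub_right_comm]
      exact T.add_mem hx (T.smul_mem t hv)

theorem isSubmanifoldAt_of_locally_affine [FiniteDimensional ℝ E] {M : Set E} {x p : E}
    {T : Submodule ℝ E} (hx : x ∈ M) (h : ∀ᶠ u in 𝓝 x, (u ∈ M ↔ u - p ∈ T)) :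
    IsSubmanifoldAt M x := by
  let e := (stdOrthonormalBasis ℝ Tᗮ).repr
  let l : E →L[ℝ] EuclideanSpace ℝ (Fin (Module.finrank ℝ Tᗮ)) :=
    (e.toContinuousLinearEquiv : Tᗮ →L[ℝ] _).comp Tᗮ.orthogonalProjectionOnto
  have hd : HasFDerivAt (fun u => l (u - p)) l x :=
    l.hasFDerivAt.comp x ((hasFDerivAt_id x).sub_const p)
  refine ⟨hx, _, fun u => l (u - p), ?_, ?_, ?_⟩
  · exact l.contDiff.contDiffAt.comp x (contDiffAt_id.sub contDiffAt_const)
  · rw [hd.fderiv]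
    intro w
    refine ⟨(e.symm w : Tᗮ), ?_⟩
    simp [l]
  · filter_upwards [h] with u hu
    rw [hu]
    simp only [l, ContinuousLinearMap.comp_apply]
    rw [ContinuousLinearEquiv.coe_coe, EmbeddingLike.map_eq_zero_iff,
      Submodule.orthogonalProjectionOnto_eq_zero_iff, T.orthogonal_orthogonal]

/-! Identification of the active manifold -/

theorem eventually_mem_of_tendsto_subgradient [FiniteDimensional ℝ E] {G : E → EReal} {M : Set E}
    {xbar vbar : E} (hpart : IsPartlySmoothAt G M xbar)
    (hri : vbar ∈ intrinsicInterior ℝ (subdiff G xbar)) {x v : ℕ → E}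
    (hx : Tendsto x atTop (𝓝 xbar)) (hv : Tendsto v atTop (𝓝 vbar))
    (hxv : ∀ k, v k ∈ subdiff G (x k)) : ∀ᶠ k in atTop, x k ∈ M := by
  have : CompleteSpace E := FiniteDimensional.complete ℝ E
  obtain ⟨π, hπ, hπM⟩ := exists_normal_retraction hpart.submanifold
  obtain ⟨δ, hδ, hball⟩ := exists_add_mem_of_mem_intrinsicInterior hri
  by_contra hcon
  obtain ⟨s, hs, hsM⟩ := extraction_of_frequently_atTop (not_eventually.mp hcon)
  obtain ⟨N, hN⟩ := eventually_atTop.mp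
    ((hx.comp hs.tendsto_atTop).eventually hπM)
  have hprop : ∀ j, x (s (j + N)) ∉ M ∧ π (x (s (j + N))) ∈ M ∧
      x (s (j + N)) - π (x (s (j + N))) ∈ (tangent M xbar)ᗮ := fun j =>
    ⟨hsM _, hN _ (Nat.le_add_left _ _)⟩
  have hidx : Tendsto (fun j => s (j + N)) atTop atTop :=
    hs.tendsto_atTop.comp (tendsto_add_atTop_nat N)
  let d : ℕ → E := fun j => x (s (j + N)) - π (x (s (j + N)))
  have hd : ∀ j, d j ≠ 0 := fun j h0 => (hprop j).1 (by
    rw [sub_eq_zero.mp h0]; exact (hprop j).2.1)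
  let u : ℕ → E := fun j => ‖d j‖⁻¹ • d j
  have hu : ∀ j, u j ∈ Metric.sphere (0 : E) 1 := fun j => by
    rw [mem_sphere_zero_iff_norm, norm_smul, norm_inv, norm_norm,
      inv_mul_cancel₀ (norm_ne_zero_iff.mpr (hd j))]
  obtain ⟨nu, hnu, t, ht, hlim⟩ := (isCompact_sphere (0 : E) 1).tendsto_subseq hu
  have hnu1 : ‖nu‖ = 1 := mem_sphere_zero_iff_norm.mp hnu
  have hnuT : nu ∈ (tangent M xbar)ᗮ :=
    (tangent M xbar).isClosed_orthogonal.mem_of_tendsto hlim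
      (Eventually.of_forall fun j => Submodule.smul_mem _ _ (hprop (t j)).2.2)
  -- Sharpness makes the normal `nu` an admissible direction in `∂G(xbar)`. Inner semicontinuity
  -- provides subgradients `w` at the retracted points within `δ / 4` of this vector; monotonicity
  -- against `w` bounds the limit below by `-δ / 4`, while its value is `-δ / 2`.
  have hmem : vbar + (δ / 2) • nu ∈ subdiff G xbar := by
    refine hball _ ?_ ?_
    · rw [hpart.sharp]
      exact Submodule.smul_mem _ _ hnuT
    · rw [norm_smul, hnu1, Real.norm_of_nonneg (by positivity)]
      linarith
  have hvt : Tendsto (fun j => v (s (t j + N))) atTop (𝓝 vbar) :=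
    hv.comp (hidx.comp ht.tendsto_atTop)
  have hπt : Tendsto (fun j => π (x (s (t j + N)))) atTop (𝓝[M] xbar) :=
    tendsto_nhdsWithin_iff.mpr ⟨hπ.comp (hx.comp (hidx.comp ht.tendsto_atTop)),
      Eventually.of_forall fun j => (hprop (t j)).2.1⟩
  have hev := hπt.eventually (hpart.continuous.1 _ hmem (δ / 4) (by positivity))
  have hlim2 : Tendsto (fun j => ⟪v (s (t j + N)) - (vbar + (δ / 2) • nu), (u ∘ t) j⟫) atTop
      (𝓝 (⟪vbar - (vbar + (δ / 2) • nu), nu⟫)) :=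
    (hvt.sub tendsto_const_nhds).inner hlim
  have hge : -(δ / 4) ≤ ⟪vbar - (vbar + (δ / 2) • nu), nu⟫ := by
    refine ge_of_tendsto hlim2 ?_
    filter_upwards [hev] with j hj
    obtain ⟨w, hw, hwn⟩ := hj
    have hmono := subdiff_monotone hpart.gammaZero (hxv (s (t j + N))) hw
    have h1 : 0 ≤ ⟪v (s (t j + N)) - w, u (t j)⟫ := by
      change 0 ≤ ⟪_, ‖d (t j)‖⁻¹ • d (t j)⟫
      rw [real_inner_smul_right]
      exact mul_nonneg (by positivity) hmono
    have h2 : |⟪w - (vbar + (δ / 2) • nu), u (t j)⟫| ≤ δ / 4 := by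
      refine (abs_real_inner_le_norm _ _).trans ?_
      rw [mem_sphere_zero_iff_norm.mp (hu (t j)), mul_one]
      exact hwn.le
    have h3 : v (s (t j + N)) - (vbar + (δ / 2) • nu) =
        (v (s (t j + N)) - w) + (w - (vbar + (δ / 2) • nu)) := by abel
    rw [Function.comp_apply, h3, inner_add_left]
    linarith [neg_le_of_abs_le h2]
  rw [sub_add_cancel_left, inner_neg_left, real_inner_smul_left, real_inner_self_eq_norm_sq,
    hnu1] at hge
  linarith

/-! The polyhedral case -/

/-- Doubling the displacement from `(xbar, c)` preserves the constraints active there, which are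
homogeneous about that point; the inactive ones stay strict by continuity. -/
theorem eventually_reflection_le {G : E → EReal} {xbar : E} {c : ℝ} (hc : G xbar = c)
    (hpoly : IsLocallyPolyhedralAt G xbar) :
    ∀ᶠ q in 𝓝 (xbar, c), G q.1 ≤ (q.2 : EReal) →
      G ((2 : ℝ) • q.1 - xbar) ≤ ((2 * q.2 - c : ℝ) : EReal) := by
  obtain ⟨P, m, p, s, b, hP, hGP⟩ := hpoly
  have hiff : ∀ q : E × ℝ, P q.1 ≤ (q.2 : EReal) ↔ ∀ i, ⟪p i, q.1⟫ + s i * q.2 ≤ b i :=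
    fun q => Set.ext_iff.mp hP q
  have h0 : ∀ i, ⟪p i, xbar⟫ + s i * c ≤ b i :=
    (hiff (xbar, c)).mp (by rw [← hGP.self_of_nhds, hc])
  have hfst : Tendsto (fun q : E × ℝ => q.1) (𝓝 (xbar, c)) (𝓝 xbar) :=
    continuous_fst.tendsto _
  have hrefl : Tendsto (fun q : E × ℝ => (2 : ℝ) • q.1 - xbar) (𝓝 (xbar, c)) (𝓝 xbar) := by
    have : Continuous fun q : E × ℝ => (2 : ℝ) • q.1 - xbar := by fun_prop
    have h := this.tendsto (xbar, c)
    simpa [two_smul] using h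
  have hi : ∀ᶠ q in 𝓝 (xbar, c), ∀ i, ⟪p i, xbar⟫ + s i * c < b i →
      ⟪p i, (2 : ℝ) • q.1 - xbar⟫ + s i * (2 * q.2 - c) < b i := by
    refine eventually_all.mpr fun i => ?_
    by_cases hlt : ⟪p i, xbar⟫ + s i * c < b i
    · have hcont : Continuous fun q : E × ℝ =>
          ⟪p i, (2 : ℝ) • q.1 - xbar⟫ + s i * (2 * q.2 - c) := by fun_prop
      have h := hcont.tendsto (xbar, c)
      have heq : ⟪p i, (2 : ℝ) • xbar - xbar⟫ + s i * (2 * c - c) = ⟪p i, xbar⟫ + s i * c := by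
        rw [two_smul, add_sub_cancel_right]
        ring
      simp only [heq] at h
      exact (h.eventually (gt_mem_nhds hlt)).mono fun q hq _ => hq
    · exact Eventually.of_forall fun q hq => absurd hq hlt
  filter_upwards [hfst.eventually hGP, hrefl.eventually hGP, hi] with q h1 h2 h3 hq
  rw [h1] at hq
  rw [h2]
  refine (hiff ((2 : ℝ) • q.1 - xbar, 2 * q.2 - c)).mpr fun i => ?_
  rcases (h0 i).lt_or_eq with hlt | heq
  · exact (h3 i hlt).le
  · have := (hiff q).mp hq i
    simp only [inner_sub_right, real_inner_smul_right]
    linarith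

/-- Testing `w` at `xbar` and at the doubled point `2u - xbar` gives opposite inequalities, so `G`
attains its affine minorant of slope `w` at both `u` and `xbar`. -/
theorem eventually_subdiff_subset {G : E → EReal} {M : Set E} {xbar : E}
    (hpart : IsPartlySmoothAt G M xbar) {c : ℝ} (hc : G xbar = c)
    (hpoly : IsLocallyPolyhedralAt G xbar) :
    ∀ᶠ u in 𝓝[M] xbar, ∀ w ∈ subdiff G u, w ∈ subdiff G xbar ∧
      G u = ((c + ⟪w, u - xbar⟫ : ℝ) : EReal) := by
  obtain ⟨g, hgC, hg⟩ := hpart.smooth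
  have hgx : g xbar = c := by
    have h := hg.self_of_nhdsWithin hpart.submanifold.1
    rw [hc] at h
    exact_mod_cast h.symm
  -- Continuity of `G` along `M` brings its graph into the neighbourhood where doubling is allowed.
  have htend : Tendsto (fun u => (u, g u)) (𝓝[M] xbar) (𝓝 (xbar, c)) := by
    have h : Tendsto g (𝓝 xbar) (𝓝 c) := hgx ▸ hgC.continuousAt.tendsto
    exact (tendsto_id.prodMk_nhds h).mono_left nhdsWithin_le_nhds
  filter_upwards [hg, htend.eventually (eventually_reflection_le hc hpoly)] with u hu hr w hw
  have h1 := le_of_mem_subdiff hw hu hc.le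
  have h2 := le_of_mem_subdiff hw hu (hr hu.le)
  have e1 : ⟪w, xbar - u⟫ = -⟪w, u - xbar⟫ := by rw [← inner_neg_right, neg_sub]
  have e2 : (2 : ℝ) • u - xbar - u = u - xbar := by rw [two_smul]; abel
  rw [e1] at h1
  rw [e2] at h2
  have hval : g u = c + ⟪w, u - xbar⟫ := by linarith
  refine ⟨fun q => ?_, by rw [hu, hval]⟩
  have h3 := hw q
  rw [hu, hval, ← EReal.coe_add] at h3
  rw [hc, ← EReal.coe_add]
  refine le_trans (le_of_eq ?_) h3
  have e3 : q - xbar = (q - u) + (u - xbar) := by abel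
  rw [e3, inner_add_right]
  congr 1
  ring

theorem eventually_mem_iff_of_polyhedral [FiniteDimensional ℝ E] {G : E → EReal} {M : Set E}
    {xbar vbar : E} (hpart : IsPartlySmoothAt G M xbar)
    (hri : vbar ∈ intrinsicInterior ℝ (subdiff G xbar)) {c : ℝ} (hc : G xbar = c)
    (hpoly : IsLocallyPolyhedralAt G xbar) :
    ∀ᶠ u in 𝓝 xbar, (u ∈ M ↔ u - xbar ∈ tangent M xbar) ∧
      (u ∈ M → G u = ((c + ⟪vbar, u - xbar⟫ : ℝ) : EReal)) := by
  have : CompleteSpace E := FiniteDimensional.complete ℝ E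
  obtain ⟨π, hπ, hπM⟩ := exists_normal_retraction hpart.submanifold
  obtain ⟨δ, hδ, hball⟩ := exists_add_mem_of_mem_intrinsicInterior hri
  have hvbar : vbar ∈ subdiff G xbar := intrinsicInterior_subset hri
  have hdir : ∀ᶠ u in 𝓝[M] xbar, u - xbar ∈ tangent M xbar ∧
      G u = ((c + ⟪vbar, u - xbar⟫ : ℝ) : EReal) := by
    filter_upwards [eventually_subdiff_subset hpart hc hpoly,
      hpart.continuous.1 vbar hvbar (δ / 2) (by positivity)] with u hu hw
    obtain ⟨w, hw, hwn⟩ := hw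
    obtain ⟨hwx, hval⟩ := hu w hw
    have hspan : w - vbar ∈ vectorSpan ℝ (subdiff G xbar) := vsub_mem_vectorSpan ℝ hwx hvbar
    -- The nearby subgradient `w` can be moved slightly along `e` inside `∂G(xbar)`, yet `w` already
    -- attains the value `G u`. Using `-e` as well puts `u - xbar` in the tangent space.
    have key : ∀ e ∈ vectorSpan ℝ (subdiff G xbar), ⟪e, u - xbar⟫ ≤ 0 := by
      intro e he
      set r : ℝ := δ / (2 * (‖e‖ + 1)) with hr
      have hrpos : 0 < r := by positivity
      have hre : ‖r • e‖ ≤ δ / 2 := by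
        rw [norm_smul, Real.norm_of_nonneg hrpos.le, hr, div_mul_eq_mul_div,
          div_le_div_iff₀ (by positivity) two_pos]
        nlinarith [norm_nonneg e]
      have hm : vbar + ((w - vbar) + r • e) ∈ subdiff G xbar :=
        hball _ (Submodule.add_mem _ hspan (Submodule.smul_mem _ _ he))
          ((norm_add_le _ _).trans_lt (by linarith))
      have hle := le_of_mem_subdiff hm hc hval.le
      rw [← add_assoc, add_sub_cancel, inner_add_left, real_inner_smul_left] at hle
      nlinarith
    have hT : u - xbar ∈ tangent M xbar := by
      rw [← (tangent M xbar).orthogonal_orthogonal, ← hpart.sharp,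
        Submodule.mem_orthogonal]
      intro e he
      have h2 := key (-e) (Submodule.neg_mem _ he)
      rw [inner_neg_left] at h2
      exact le_antisymm (key e he) (by linarith)
    refine ⟨hT, ?_⟩
    have h0 : ⟪w - vbar, u - xbar⟫ = 0 := by
      rw [hpart.sharp] at hspan
      rw [real_inner_comm]
      exact hspan _ hT
    rw [inner_sub_left, sub_eq_zero] at h0
    rw [hval, h0]
  have hdir' := eventually_nhdsWithin_iff.mp hdir
  filter_upwards [hdir', hπM, hπ.eventually hdir'] with u hu hπu hπd
  refine ⟨⟨fun hm => (hu hm).1, fun hT => ?_⟩, fun hm => (hu hm).2⟩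
  -- Conversely, the offset `u - π u` is both tangent and normal, hence zero.
  have h1 : u - π u ∈ tangent M xbar := by
    have := Submodule.sub_mem _ hT (hπd hπu.1).1
    rwa [sub_sub_sub_cancel_right] at this
  have h2 : u - π u = 0 := inner_self_eq_zero.mp (hπu.2 _ h1 : ⟪u - π u, u - π u⟫ = 0)
  rw [sub_eq_zero.mp h2]
  exact hπu.1

/-- The tangent space is `T` all along `M` near `x`, so the Riemannian gradient of the affine
representative is the constant projection of `v`. -/
theorem hasRiemHessianAt_zero_of_locally_affine [FiniteDimensional ℝ E] [CompleteSpace E]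
    {G : E → EReal} {M : Set E} {x p v : E} {c : ℝ} {T : Submodule ℝ E} (hx : x ∈ M)
    (h : ∀ᶠ u in 𝓝 x, (u ∈ M ↔ u - p ∈ T) ∧
      (u ∈ M → G u = ((c + ⟪v, u - p⟫ : ℝ) : EReal))) :
    HasRiemHessianAt M G x 0 := by
  have hgrad : ∀ u, gradient (fun u => c + ⟪v, u - p⟫) u = v := by
    intro u
    refine HasGradientAt.gradient ?_
    rw [hasGradientAt_iff_hasFDerivAt]
    have h1 : HasFDerivAt (fun u => innerSL ℝ v (u - p)) (innerSL ℝ v) u :=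
      (innerSL ℝ v).hasFDerivAt.comp u ((hasFDerivAt_id u).sub_const p)
    exact h1.const_add c
  have htan : ∀ᶠ u in 𝓝[M] x, tangent M u = T := by
    rw [eventually_nhdsWithin_iff]
    filter_upwards [h.eventually_nhds] with u hu hm
    exact tangent_eq_of_locally_affine (hu.self_of_nhds.1.mp hm) (hu.mono fun _ hq => hq.1)
  refine ⟨isSubmanifoldAt_of_locally_affine hx (h.mono fun _ hq => hq.1),
    fun u => c + ⟪v, u - p⟫, ⟨?_, ?_⟩, 0, ?_, ?_⟩
  · exact contDiffAt_const.add (contDiffAt_const.inner ℝ (contDiffAt_id.sub contDiffAt_const))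
  · rw [eventually_nhdsWithin_iff]
    exact h.mono fun _ hq => hq.2
  · have hconst : ∀ᶠ u in 𝓝[M] x,
        riemGradient M (fun u => c + ⟪v, u - p⟫) u = T.starProjection v := by
      filter_upwards [htan] with u hu
      simp only [riemGradient, hgrad]
      congr 2
    exact (hasFDerivWithinAt_const (T.starProjection v) x M).congr_of_eventuallyEq hconst
      (hconst.self_of_nhdsWithin hx)
  · intro w
    simp

/-! Convergence of the algorithm -/

theorem continuous_gradient [CompleteSpace E] {f : E → ℝ} (hf : ContDiff ℝ 1 f) :
    Continuous (gradient f) :=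
  (InnerProductSpace.toDual ℝ E).symm.continuous.comp (hf.continuous_fderiv one_ne_zero)

section Algorithm

variable [CompleteSpace E] {F ψ : E → ℝ} {G : E → EReal} {L κ aMin aMax : ℝ} {a : ℕ → ℝ}
  {x y z : ℕ → E} {xbar : E}

theorem IsIBPG.mem_Icc (halg : IsIBPG F ψ G L κ aMin aMax a x y z) (k : ℕ) :
    a k ∈ Set.Icc aMin 1 := by
  cases k with
  | zero => rw [halg.a_zero]; exact ⟨halg.aMin_lt.le.trans halg.aMax_le, le_rfl⟩
  | succ k => exact ⟨(halg.a_succ_mem k).1, (halg.a_succ_mem k).2.trans halg.aMax_le⟩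

theorem IsIBPG.tendsto_z (halg : IsIBPG F ψ G L κ aMin aMax a x y z)
    (hlim : Tendsto x atTop (𝓝 xbar)) : Tendsto z atTop (𝓝 xbar) := by
  rw [← tendsto_add_atTop_iff_nat 1]
  have hlim1 := (tendsto_add_atTop_iff_nat 1).mpr hlim
  have hd : Tendsto (fun k => a k • (x (k + 1) - x k)) atTop (𝓝 0) := by
    have h0 : Tendsto (fun k => ‖x (k + 1) - x k‖) atTop (𝓝 0) := by
      simpa using (hlim1.sub hlim).norm
    refine squeeze_zero_norm (fun k => ?_) h0
    obtain ⟨h1, h2⟩ := halg.mem_Icc k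
    rw [norm_smul, Real.norm_of_nonneg (halg.aMin_pos.le.trans h1)]
    exact mul_le_of_le_one_left (norm_nonneg _) h2
  simpa [halg.z_succ] using hlim.add hd

theorem IsIBPG.tendsto_y (halg : IsIBPG F ψ G L κ aMin aMax a x y z)
    (hlim : Tendsto x atTop (𝓝 xbar)) : Tendsto y atTop (𝓝 xbar) := by
  have hz := halg.tendsto_z hlim
  have hd : Tendsto (fun k => a k • (x k - z k)) atTop (𝓝 0) := by
    have h0 : Tendsto (fun k => ‖x k - z k‖) atTop (𝓝 0) := by
      simpa using (hlim.sub hz).norm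
    refine squeeze_zero_norm (fun k => ?_) h0
    obtain ⟨h1, h2⟩ := halg.mem_Icc k
    rw [norm_smul, Real.norm_of_nonneg (halg.aMin_pos.le.trans h1)]
    exact mul_le_of_le_one_left (norm_nonneg _) h2
  rw [funext halg.y_eq]
  simpa using hz.add hd

theorem IsIBPG.exists_subgradients (halg : IsIBPG F ψ G L κ aMin aMax a x y z) (hL : 0 < L)
    (hF : ContDiff ℝ 1 F) (hψ : ContDiff ℝ 1 ψ) (hlim : Tendsto x atTop (𝓝 xbar)) :
    ∃ v : ℕ → E, (∀ k, v k ∈ subdiff G (x (k + 1))) ∧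
      Tendsto v atTop (𝓝 (-gradient F xbar)) := by
  choose v hv hveq using halg.x_succ
  refine ⟨v, hv, ?_⟩
  have hy := halg.tendsto_y hlim
  have hlim1 := (tendsto_add_atTop_iff_nat 1).mpr hlim
  have hψ0 : Tendsto (fun k => gradient ψ (y k) - gradient ψ (x (k + 1))) atTop (𝓝 0) := by
    have hc := (continuous_gradient hψ).tendsto xbar
    simpa using (hc.comp hy).sub (hc.comp hlim1)
  -- A uniform lower bound for the step sizes, as `κ - 1 > 0`; it lets the division by `γₖ` preserve
  -- convergence to zero.
  set γ : ℝ := aMin ^ (κ - 1) / L with hγ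
  have hγ0 : 0 < γ := div_pos (Real.rpow_pos_of_pos halg.aMin_pos _) hL
  have hstep : ∀ k, γ ≤ stepSize L κ a k := fun k =>
    div_le_div_of_nonneg_right
      (Real.rpow_le_rpow halg.aMin_pos.le (halg.mem_Icc k).1 (by linarith [halg.kappa_gt])) hL.le
  have hs : Tendsto (fun k => (stepSize L κ a k)⁻¹ •
      (gradient ψ (y k) - gradient ψ (x (k + 1)))) atTop (𝓝 0) := by
    have h0 : Tendsto (fun k => γ⁻¹ * ‖gradient ψ (y k) - gradient ψ (x (k + 1))‖) atTop
        (𝓝 0) := by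
      simpa using hψ0.norm.const_mul γ⁻¹
    refine squeeze_zero_norm (fun k => ?_) h0
    rw [norm_smul, norm_inv, Real.norm_of_nonneg (hγ0.le.trans (hstep k))]
    gcongr
    exact hstep k
  have hval : ∀ k, v k = (stepSize L κ a k)⁻¹ • (gradient ψ (y k) - gradient ψ (x (k + 1))) -
      gradient F (y k) := by
    intro k
    have hne : stepSize L κ a k ≠ 0 := (hγ0.trans_le (hstep k)).ne'
    have h1 : stepSize L κ a k • v k =
        (gradient ψ (y k) - gradient ψ (x (k + 1))) - stepSize L κ a k • gradient F (y k) := by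
      rw [eq_sub_of_add_eq' (hveq k)]
      abel
    rw [← inv_smul_smul₀ hne (v k), h1, smul_sub, inv_smul_smul₀ hne]
  rw [funext hval, ← zero_sub (gradient F xbar)]
  exact hs.sub (((continuous_gradient hF).tendsto xbar).comp hy)

end Algorithm

end IBPG

theorem lemma4p2 (n : ℕ)
    (F ψ : EuclideanSpace ℝ (Fin n) → ℝ) (G : EuclideanSpace ℝ (Fin n) → EReal)
    (hF : ContDiff ℝ 1 F)
    (hG : IsGammaZero G)
    (hbdd : ∃ c : ℝ, ∀ u, (c : EReal) ≤ objective F G u)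
    (σ : ℝ) (hσ : 0 < σ)
    (hψ : ContDiff ℝ 2 ψ) (hψσ : StrongConvexOn Set.univ σ ψ)
    (L : ℝ) (hL : 0 < L) (hrel : ConvexOn ℝ Set.univ (fun u => L * ψ u - F u))
    (hFlip : LipschitzOnBounded (gradient F)) (hψlip : LipschitzOnBounded (gradient ψ))
    (κ aMin aMax : ℝ) (a : ℕ → ℝ) (x y z : ℕ → EuclideanSpace ℝ (Fin n))
    (halg : IsIBPG F ψ G L κ aMin aMax a x y z)
    (hxbdd : Bornology.IsBounded (Set.range x))
    (xbar : EuclideanSpace ℝ (Fin n)) (hlim : Filter.Tendsto x Filter.atTop (nhds xbar))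
    (hcrit : IsCritical (objective F G) xbar)
    (M : Set (EuclideanSpace ℝ (Fin n))) (hpart : IsPartlySmoothAt G M xbar)
    (hnd : IsNondegenerate F G xbar) :
    ∃ K : ℕ,
      (∀ k ≥ K, x k ∈ M) ∧
      ((∃ A : AffineSubspace ℝ (EuclideanSpace ℝ (Fin n)), (A : Set (EuclideanSpace ℝ (Fin n))) = M) →
        M = {u | ∃ t ∈ tangent M xbar, u = xbar + t} ∧ ∀ k ≥ K, y k ∈ M ∧ z k ∈ M) ∧
      (IsLocallyPolyhedralAt G xbar →
        ∀ k ≥ K, y k ∈ M ∧ z k ∈ M ∧ HasRiemHessianAt M G (x k) 0) := by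
  have hri := hnd.2
  obtain ⟨v, hv, hvlim⟩ := halg.exists_subgradients hL hF (hψ.of_le (by norm_num)) hlim
  have hlim1 := (tendsto_add_atTop_iff_nat 1).mpr hlim
  have hxM : ∀ᶠ k in atTop, x k ∈ M := by
    obtain ⟨N, hN⟩ := eventually_atTop.mp
      (eventually_mem_of_tendsto_subgradient hpart hri hlim1 hvlim hv)
    -- The shift by one appears because the subgradient `v k` belongs to `x (k + 1)`.
    refine eventually_atTop.mpr ⟨N + 1, fun k hk => ?_⟩
    obtain ⟨j, rfl⟩ := Nat.exists_eq_add_of_le' (Nat.one_le_of_lt hk)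
    exact hN j (by omega)
  have haffine : ∀ A : AffineSubspace ℝ (EuclideanSpace ℝ (Fin n)), ∀ k, x k ∈ A →
      x (k + 1) ∈ A → z (k + 1) ∈ A ∧ y (k + 1) ∈ A := by
    intro A k h0 h1
    have hline : ∀ (t : ℝ) (p q : EuclideanSpace ℝ (Fin n)), p ∈ A → q ∈ A →
        p + t • (q - p) ∈ A := fun t p q hp hq => by
      have h := AffineMap.lineMap_mem t hp hq
      rwa [AffineMap.lineMap_apply, vsub_eq_sub, vadd_eq_add, add_comm] at h
    have hz : z (k + 1) ∈ A := by rw [halg.z_succ]; exact hline _ _ _ h0 h1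
    exact ⟨hz, by rw [halg.y_eq]; exact hline _ _ _ hz h1⟩
  -- The polyhedral claim is kept as an implication inside the eventuality so that a single `K`
  -- serves every conclusion.
  have hK : ∀ᶠ k in atTop, x k ∈ M ∧ (IsLocallyPolyhedralAt G xbar →
      y k ∈ M ∧ z k ∈ M ∧ HasRiemHessianAt M G (x k) 0) := by
    by_cases hpoly : IsLocallyPolyhedralAt G xbar
    · obtain ⟨c, hc⟩ := exists_coe_of_mem_subdiff hG (intrinsicInterior_subset hri)
      have hloc := eventually_mem_iff_of_polyhedral hpart hri hc hpoly
      have hall : ∀ᶠ k in atTop, x (k + 1) ∈ M ∧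
          (y (k + 1) ∈ M ∧ z (k + 1) ∈ M ∧ HasRiemHessianAt M G (x (k + 1)) 0) := by
        filter_upwards [hxM, (tendsto_add_atTop_nat 1).eventually hxM, hlim.eventually hloc,
          hlim1.eventually hloc, ((tendsto_add_atTop_iff_nat 1).mpr
            (halg.tendsto_y hlim)).eventually hloc, ((tendsto_add_atTop_iff_nat 1).mpr
            (halg.tendsto_z hlim)).eventually hloc, hlim1.eventually hloc.eventually_nhds]
          with k hk hk1 hx0 hx1 hy1 hz1 hnear
        have hA : ∀ u, u ∈ AffineSubspace.mk' xbar (tangent M xbar) ↔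
            u - xbar ∈ tangent M xbar := fun u => by
          rw [AffineSubspace.mem_mk', vsub_eq_sub]
        obtain ⟨hz, hy⟩ := haffine _ k ((hA _).mpr (hx0.1.mp hk)) ((hA _).mpr (hx1.1.mp hk1))
        exact ⟨hk1, hy1.1.mpr ((hA _).mp hy), hz1.1.mpr ((hA _).mp hz),
          hasRiemHessianAt_zero_of_locally_affine hk1 hnear⟩
      obtain ⟨N, hN⟩ := eventually_atTop.mp hall
      refine eventually_atTop.mpr ⟨N + 1, fun k hk => ?_⟩
      obtain ⟨j, rfl⟩ := Nat.exists_eq_add_of_le' (Nat.one_le_of_lt hk)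
      obtain ⟨h1, h2⟩ := hN j (by omega)
      exact ⟨h1, fun _ => h2⟩
    · exact hxM.mono fun k hk => ⟨hk, fun h => absurd h hpoly⟩
  obtain ⟨K, hK⟩ := eventually_atTop.mp hK
  -- One extra index: in the affine case `y k` and `z k` also need `x (k - 1) ∈ M`.
  refine ⟨K + 1, fun k hk => (hK k (by omega)).1, ?_,
    fun hpoly k hk => (hK k (by omega)).2 hpoly⟩
  rintro ⟨A, rfl⟩
  have hxA : xbar ∈ A := hpart.submanifold.1
  have hmem : ∀ u, u ∈ A ↔ u - xbar ∈ A.direction := fun u =>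
    (AffineSubspace.vsub_right_mem_direction_iff_mem hxA u).symm
  have htan : tangent (A : Set (EuclideanSpace ℝ (Fin n))) xbar = A.direction :=
    tangent_eq_of_locally_affine (p := xbar) (by simp) (Eventually.of_forall hmem)
  constructor
  · ext u
    rw [htan, SetLike.mem_coe, hmem]
    exact ⟨fun h => ⟨_, h, by abel⟩, by rintro ⟨t, ht, rfl⟩; simpa using ht⟩
  · intro k hk
    obtain ⟨j, rfl⟩ := Nat.exists_eq_add_of_le' (Nat.one_le_of_lt hk)
    have h := haffine A j (hK j (by omega)).1 (hK (j + 1) (by omega)).1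
    exact ⟨h.2, h.1⟩
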